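/- Conventions. For a valued field $(K,\nu,\Gamma)$ (with $\nu:K^{\times}\to\Gamma$ surjective onto an ordered abelian group $\Gamma$) let $R$ be its valuation ring, $\mathfrak m$ the maximal ideal of $R$, $k=R/\mathfrak m$ the residue field, and $R_n=R/\mathfrak m^n$ the $n$-th residue ring ($n\ge 1$). It has mixed characteristic $(0,p)$ if $\operatorname{char}K=0$ and $\operatorname{char}k=p>0$; its absolute ramification index is then the cardinality of $\{\gamma\in\Gamma : 0<\gamma\le\nu(p)\}$, and it is finitely ramified if this set is finite. Elementary equivalence $\equiv$ and theories of valued fields are taken in the three-sorted first-order language with sorts for the field and the residue field (ring language $+,-,\cdot,0,1$), and the value group (language $+,0,<$), together with the valuation and the residue map; residue rings are compared in the ring language, value groups in the language $\{+,0,<\}$. A $\mathbb Z$-group is an ordered abelian group elementarily equivalent to $\mathbb Z$. For $T=\operatorname{Th}(K,\nu)$, where $(K,\nu,\Gamma)$ is a henselian valued field of mixed characteristic with finite absolute ramification index, let $\lambda(T)\in\mathbb N\cup\{\infty\}$ be the smallest positive integer $n$ such that for every henselian valued field $(K',\nu',\Gamma')$ of mixed characteristic with the same absolute ramification index as $(K,\nu,\Gamma)$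 the following are equivalent: (1) $(K',\nu',\Gamma')\models T$; (2) $\Gamma\equiv\Gamma'$ and the $n$-th residue rings of $(K,\nu)$ and $(K',\nu')$ are elementarily equivalent. If no such $n$ exists, $\lambda(T)=\infty$. Proposition. Let $p$ be a prime number and $e\ge 2$ an integer divisible by $p$. Let $(K,\nu,\Gamma,k)$ be a finitely ramified henselian valued field of mixed characteristic $(0,p)$ with absolute ramification index $e$. Suppose that $k$ is perfect and that $\Gamma$ is a $\mathbb Z$-group. Then $\lambda(T)\ge e+1$ for $T=\operatorname{Th}(K,\nu)$. -/

import Mathlib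

universe u v

namespace ValuedFieldTheory

open FirstOrder

/-! ### The first-order languages of the three sorts

The valued field and the residue field use `FirstOrder.Language.ring`, with symbols
`+, *, -, 0, 1`. The value group uses the language `{+, 0, <}` of ordered groups. -/

/-- Function symbols of the language of ordered groups: `0` and `+`. -/
inductive OrdGroupFunc : ℕ → Type
  | zero : OrdGroupFunc 0
  | add : OrdGroupFunc 2

/-- Relation symbols of the language of ordered groups: `<`. -/
inductive OrdGroupRel : ℕ → Type
  | lt : OrdGroupRel 2

/-- The language `{+, 0, <}` of ordered groups. -/
def ordGroupLang : Language where
  Functions := OrdGroupFunc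
  Relations := OrdGroupRel

/-- An ordered abelian group as a structure for the language of ordered groups. -/
@[reducible]
def ordGroupStructure (G : Type*) [AddCommGroup G] [LinearOrder G] :
    ordGroupLang.Structure G where
  funMap := fun {_} f => match f with
    | .zero => fun _ => 0
    | .add => fun x => x 0 + x 1
  RelMap := fun {_} r => match r with
    | .lt => fun x => x 0 < x 1

/-- Elementary equivalence of rings in the language of rings. -/
def RingElemEquiv (R S : Type*) [CommRing R] [CommRing S] : Prop :=
  letI := Ring.compatibleRingOfRing R
  letI := Ring.compatibleRingOfRing S
  Language.ElementarilyEquivalent Language.ring R S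

/-- Elementary equivalence of ordered abelian groups in the language `{+, 0, <}`. -/
def OrdGroupElemEquiv (G H : Type*) [AddCommGroup G] [LinearOrder G]
    [AddCommGroup H] [LinearOrder H] : Prop :=
  letI := ordGroupStructure G
  letI := ordGroupStructure H
  Language.ElementarilyEquivalent ordGroupLang G H

/-- An ordered abelian group is a `ℤ`-group if it is elementarily equivalent to the ordered
group of integers. -/
def IsOrderedZGroup (G : Type*) [AddCommGroup G] [LinearOrder G] [IsOrderedAddMonoid G] : Prop :=
  OrdGroupElemEquiv G ℤ

/-- The value of a term of the language of rings in a ring. -/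
def ringTermVal {α R : Type*} [CommRing R] (t : Language.ring.Term α) (x : α → R) : R :=
  letI := Ring.compatibleRingOfRing R
  t.realize x

/-- The value of a term of the language of ordered groups in an ordered abelian group. -/
def groupTermVal {α G : Type*} [AddCommGroup G] [LinearOrder G]
    (t : ordGroupLang.Term α) (x : α → G) : G :=
  letI := ordGroupStructure G
  t.realize x

/-! ### Valued fields

A valued field is a field `K` with a surjective additive valuation `ν : K → Γ ∪ {∞}`, where `Γ` is
an ordered abelian group. -/

section ValuedField

variable {K : Type u} [Field K] {Γ : Type v} [AddCommGroup Γ] [LinearOrder Γ]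
  [IsOrderedAddMonoid Γ]

/-- The valuation ring `{x | 0 ≤ ν x}`. -/
def valRing (ν : AddValuation K (WithTop Γ)) : ValuationSubring K :=
  (AddValuation.toValuation ν).valuationSubring

theorem mem_valRing (ν : AddValuation K (WithTop Γ)) (x : K) : x ∈ valRing ν ↔ 0 ≤ ν x :=
  Iff.rfl

/-- The `n`-th residue ring `R / 𝔪 ^ n` of a valued field with valuation ring `(R, 𝔪)`. -/
abbrev ResidueRing (ν : AddValuation K (WithTop Γ)) (n : ℕ) : Type u :=
  valRing ν ⧸ (IsLocalRing.maximalIdeal (valRing ν)) ^ n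

/-- The residue field of a valued field. -/
abbrev ResField (ν : AddValuation K (WithTop Γ)) : Type u :=
  IsLocalRing.ResidueField (valRing ν)

/-- The absolute ramification index of a valued field with residue characteristic `p > 0`: the
number of `γ ∈ Γ` such that `0 < γ ≤ ν p`, which is `⊤` if there are infinitely many. -/
noncomputable def absRamificationIndex (ν : AddValuation K (WithTop Γ)) : ℕ∞ :=
  {γ : Γ | 0 < γ ∧ (γ : WithTop Γ) ≤ ν ((ringChar (ResField ν) : ℕ) : K)}.encard

/-- `ν` makes `K` a henselian valued field of mixed characteristic with value group `Γ`. -/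
structure IsHenselianMixedChar (ν : AddValuation K (WithTop Γ)) : Prop where
  surjective : ∀ γ : Γ, ∃ x : K, ν x = γ
  henselian : HenselianLocalRing (valRing ν)
  charZero : CharZero K
  residueChar : (ringChar (ResField ν)).Prime

end ValuedField

/-! ### The three-sorted first-order language of valued fields -/

/-- Formulas of the three-sorted language of valued fields, whose sorts are the valued field, the
residue field and the value group, with the ring language on the first two sorts, the ordered group
language on the third, the valuation and the residue map. The three numbers count the free
variables of the three sorts. -/
inductive VFFormula : ℕ → ℕ → ℕ → Type
  | falsum {a b c : ℕ} : VFFormula a b c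
  | fieldEq {a b c : ℕ} (s t : Language.ring.Term (Fin a)) : VFFormula a b c
  | residueEq {a b c : ℕ} (s t : Language.ring.Term (Fin b)) : VFFormula a b c
  | groupEq {a b c : ℕ} (s t : ordGroupLang.Term (Fin c)) : VFFormula a b c
  | groupLt {a b c : ℕ} (s t : ordGroupLang.Term (Fin c)) : VFFormula a b c
  | valEq {a b c : ℕ} (s : Language.ring.Term (Fin a)) (t : ordGroupLang.Term (Fin c)) :
      VFFormula a b c
  | resEq {a b c : ℕ} (s : Language.ring.Term (Fin a)) (t : Language.ring.Term (Fin b)) :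
      VFFormula a b c
  | imp {a b c : ℕ} (φ ψ : VFFormula a b c) : VFFormula a b c
  | allField {a b c : ℕ} (φ : VFFormula (a + 1) b c) : VFFormula a b c
  | allResidue {a b c : ℕ} (φ : VFFormula a (b + 1) c) : VFFormula a b c
  | allGroup {a b c : ℕ} (φ : VFFormula a b (c + 1)) : VFFormula a b c

/-- Sentences of the language of valued fields. -/
abbrev VFSentence : Type := VFFormula 0 0 0

section Semantics

variable {K : Type u} [Field K] {Γ : Type v} [AddCommGroup Γ] [LinearOrder Γ]
  [IsOrderedAddMonoid Γ]

/-- Tarskian truth of a formula in the valued field `(K, ν)` under an assignment of the variables.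
The symbol for the valuation is read as its graph on the nonzero elements of `K` and the symbol
for the residue map as its graph on the valuation ring. -/
def VFFormula.Realize (ν : AddValuation K (WithTop Γ)) : {a b c : ℕ} → VFFormula a b c →
    (Fin a → K) → (Fin b → ResField ν) → (Fin c → Γ) → Prop
  | _, _, _, .falsum, _, _, _ => False
  | _, _, _, .fieldEq s t, x, _, _ => ringTermVal s x = ringTermVal t x
  | _, _, _, .residueEq s t, _, y, _ => ringTermVal s y = ringTermVal t y
  | _, _, _, .groupEq s t, _, _, z => groupTermVal s z = groupTermVal t z
  | _, _, _, .groupLt s t, _, _, z => groupTermVal s z < groupTermVal t z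
  | _, _, _, .valEq s t, x, _, z => ν (ringTermVal s x) = ((groupTermVal t z : Γ) : WithTop Γ)
  | _, _, _, .resEq s t, x, y, _ =>
      ∃ r : valRing ν, (r : K) = ringTermVal s x ∧
        IsLocalRing.residue (valRing ν) r = ringTermVal t y
  | _, _, _, .imp φ ψ, x, y, z => φ.Realize ν x y z → ψ.Realize ν x y z
  | _, _, _, .allField φ, x, y, z => ∀ k : K, φ.Realize ν (Fin.snoc x k) y z
  | _, _, _, .allResidue φ, x, y, z => ∀ k : ResField ν, φ.Realize ν x (Fin.snoc y k) z
  | _, _, _, .allGroup φ, x, y, z => ∀ g : Γ, φ.Realize ν x y (Fin.snoc z g)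

/-- Truth of a sentence in a valued field. -/
def Satisfies (ν : AddValuation K (WithTop Γ)) (φ : VFSentence) : Prop :=
  φ.Realize ν Fin.elim0 Fin.elim0 Fin.elim0

/-- The complete theory `Th(K, ν)` of a valued field. -/
def Th (ν : AddValuation K (WithTop Γ)) : Set VFSentence :=
  {φ | Satisfies ν φ}

/-- `(K, ν)` is a model of the set `T` of sentences. -/
def IsModel (ν : AddValuation K (WithTop Γ)) (T : Set VFSentence) : Prop :=
  ∀ φ ∈ T, Satisfies ν φ

/-! ### Basarab's invariant -/

/-- Among the henselian valued fields of mixed characteristic with the same absolute ramification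
index as `(K, ν)`, the models of `Th(K, ν)` are exactly those whose value group and `n`-th residue
ring are elementarily equivalent to those of `(K, ν)`. -/
def ResidueRingDeterminesTheory (ν : AddValuation K (WithTop Γ)) (n : ℕ) : Prop :=
  ∀ (K' : Type u) [Field K'] (Γ' : Type v) [AddCommGroup Γ'] [LinearOrder Γ']
    [IsOrderedAddMonoid Γ'] (ν' : AddValuation K' (WithTop Γ')),
    IsHenselianMixedChar ν' → absRamificationIndex ν' = absRamificationIndex ν →
      (IsModel ν' (Th ν) ↔
        OrdGroupElemEquiv Γ Γ' ∧ RingElemEquiv (ResidueRing ν n) (ResidueRing ν' n))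

/-- Basarab's invariant `λ(T)` of the theory `T = Th(K, ν)`: the least positive integer `n` such
that the value group and the `n`-th residue ring determine the theory, and `⊤` if there is none. -/
noncomputable def basarabInvariant (ν : AddValuation K (WithTop Γ)) : ℕ∞ :=
  sInf {N : ℕ∞ | ∃ n : ℕ, 1 ≤ n ∧ N = n ∧ ResidueRingDeterminesTheory ν n}

end Semantics

end ValuedFieldTheory

/-! For `n ≤ e` the prime `p` lies in `𝔪 ^ n`, so the `n`-th residue ring has characteristic `p`. As
`k` is perfect, this ring contains a coefficient field and is isomorphic to `k[X]/(X ^ n)`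
(`nonempty_trunc_equiv`). It therefore remembers only `k` and `n`, and nothing of the Eisenstein
equation of a uniformizer.

Over the Witt vectors of `k` there are two totally ramified extensions of degree `e`, given by `π ^
e = p` and by `π ^ e = p (1 - π)` (`exists_dvr_pow_eq`). Both are complete discrete valuation rings
with residue field `k` and absolute ramification index `e`. In the first, `p` has an `e`-th root. In
the second it has none: a root would make `1 - π` or its inverse a `p`-th power up to the wild case
`p ∣ e`, whereas a `p`-th power that is `1` modulo `π` is `1` modulo `π ^ 2`
(`pow_mul_one_sub_ne_pow`).

Whichever answer `K` gives to the question whether `p` is an `e`-th power, one of the two fraction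
fields gives the other. That field shares with `K` the theory of the value group and the `n`-th
residue ring, but is not a model of `Th ν` (`not_residueRingDeterminesTheory`). Hence no `n ≤ e` is
admissible. -/

namespace ValuedFieldTheory
open Polynomial IsLocalRing

/-! ### Truncations in equal characteristic -/

/-- The reduction map `R / 𝔪 ^ n → R / 𝔪`. -/
noncomputable def truncResidue (R : Type*) [CommRing R] [IsLocalRing R] {n : ℕ} (hn : n ≠ 0) :
    R ⧸ maximalIdeal R ^ n →+* ResidueField R :=
  Ideal.Quotient.factor (Ideal.pow_le_self hn)

theorem truncResidue_mk {R : Type*} [CommRing R] [IsLocalRing R] {n : ℕ} (hn : n ≠ 0) (x : R) :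
    truncResidue R hn (Ideal.Quotient.mk _ x) = residue R x := rfl

theorem truncResidue_surjective (R : Type*) [CommRing R] [IsLocalRing R] {n : ℕ} (hn : n ≠ 0) :
    Function.Surjective (truncResidue R hn) := fun y ↦ by
  obtain ⟨x, rfl⟩ := residue_surjective y
  exact ⟨Ideal.Quotient.mk _ x, rfl⟩

theorem pow_eq_zero_of_truncResidue_eq_zero {R : Type*} [CommRing R] [IsLocalRing R] {n : ℕ}
    (hn : n ≠ 0) {x : R ⧸ maximalIdeal R ^ n} (hx : truncResidue R hn x = 0) : x ^ n = 0 := by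
  obtain ⟨x, rfl⟩ := Ideal.Quotient.mk_surjective x
  rw [truncResidue_mk, residue_eq_zero_iff] at hx
  rw [← map_pow, Ideal.Quotient.eq_zero_iff_mem]
  exact Ideal.pow_mem_pow hx n

/-- In equal characteristic, a truncation `R / 𝔪 ^ n` with perfect residue field has a coefficient
field. -/
theorem exists_truncResidue_section {R : Type*} [CommRing R] [IsLocalRing R] {n p : ℕ}
    (hp : p.Prime) (hn : n ≠ 0) (hpn : (p : R) ∈ maximalIdeal R ^ n)
    [CharP (ResidueField R) p] [PerfectField (ResidueField R)] :
    ∃ s : ResidueField R →+* R ⧸ maximalIdeal R ^ n, ∀ y, truncResidue R hn (s y) = y := by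
  have : Fact p.Prime := ⟨hp⟩
  have : Nontrivial (R ⧸ maximalIdeal R ^ n) := (truncResidue R hn).domain_nontrivial
  have : CharP (R ⧸ maximalIdeal R ^ n) p := by
    refine (CharP.charP_iff_prime_eq_zero hp).2 ?_
    rw [← map_natCast (Ideal.Quotient.mk _), Ideal.Quotient.eq_zero_iff_mem]
    exact hpn
  have : PerfectRing (ResidueField R) p := PerfectField.toPerfectRing p
  -- Elements of the kernel have vanishing `n`-th power and `n ≤ p ^ n`, so the `n`-fold Frobenius
  -- kills them and factors through the residue field.
  have hker : RingHom.ker (truncResidue R hn) ≤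
      RingHom.ker (iterateFrobenius (R ⧸ maximalIdeal R ^ n) p n) := fun x hx ↦ by
    rw [RingHom.mem_ker, iterateFrobenius_def]
    exact pow_eq_zero_of_le (Nat.lt_pow_self hp.one_lt).le
      (pow_eq_zero_of_truncResidue_eq_zero hn hx)
  let s := (truncResidue R hn).liftOfSurjective (truncResidue_surjective R hn)
    ⟨iterateFrobenius (R ⧸ maximalIdeal R ^ n) p n, hker⟩
  -- `s` splits the reduction only up to the `n`-fold Frobenius, which is invertible on a perfect
  -- residue field.
  refine ⟨s.comp (iterateFrobeniusEquiv (ResidueField R) p n).symm.toRingHom, fun y ↦ ?_⟩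
  obtain ⟨y, rfl⟩ := (iterateFrobeniusEquiv (ResidueField R) p n).surjective y
  obtain ⟨x, rfl⟩ := truncResidue_surjective R hn y
  have hsx : s (truncResidue R hn x) = iterateFrobenius _ p n x :=
    RingHom.liftOfRightInverse_comp_apply _ _ _ _ _
  change truncResidue R hn (s ((iterateFrobeniusEquiv _ p n).symm
    (iterateFrobeniusEquiv _ p n (truncResidue R hn x)))) = _
  rw [RingEquiv.symm_apply_apply, hsx, iterateFrobenius_def, map_pow, iterateFrobeniusEquiv_apply,
    iterateFrobenius_def]

/-- Truncations in equal characteristic with perfect residue field are truncated polynomial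
rings over the residue field. -/
theorem nonempty_trunc_equiv {R : Type*} [CommRing R] [IsDomain R] [IsLocalRing R] {n p : ℕ}
    (hp : p.Prime) (hn : n ≠ 0) (hpn : (p : R) ∈ maximalIdeal R ^ n)
    [CharP (ResidueField R) p] [PerfectField (ResidueField R)] {π : R} (hπ0 : π ≠ 0)
    (hπ : maximalIdeal R = Ideal.span {π}) :
    Nonempty ((R ⧸ maximalIdeal R ^ n) ≃+*
      (ResidueField R)[X] ⧸ Ideal.span {(X : (ResidueField R)[X]) ^ n}) := by
  obtain ⟨s, hs⟩ := exists_truncResidue_section hp hn hpn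
  set t : R ⧸ maximalIdeal R ^ n := Ideal.Quotient.mk _ π with ht
  have htn : t ^ n = 0 := by
    rw [ht, ← map_pow, Ideal.Quotient.eq_zero_iff_mem]
    exact Ideal.pow_mem_pow (hπ ▸ Ideal.mem_span_singleton_self π) n
  have hres : ∀ x, truncResidue R hn x = 0 → ∃ y, x = t * y := by
    intro x hx
    obtain ⟨x, rfl⟩ := Ideal.Quotient.mk_surjective x
    rw [truncResidue_mk, residue_eq_zero_iff, hπ, Ideal.mem_span_singleton] at hx
    obtain ⟨y, rfl⟩ := hx
    exact ⟨Ideal.Quotient.mk _ y, by rw [map_mul]⟩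
  have htres : truncResidue R hn t = 0 := by
    rw [ht, truncResidue_mk, residue_eq_zero_iff, hπ]
    exact Ideal.mem_span_singleton_self π
  let ev := eval₂RingHom s t
  have hevX : ev X = t := eval₂_X _ _
  have hevC (c) : ev (C c) = s c := eval₂_C _ _
  have hsurj : Function.Surjective ev := by
    -- Expansion in powers of `t` with coefficients in the coefficient field; at `j = n` the
    -- remainder vanishes.
    have key : ∀ (j : ℕ) (x : R ⧸ maximalIdeal R ^ n), ∃ f y, x = ev f + t ^ j * y := by
      intro j
      induction j with
      | zero => exact fun x ↦ ⟨0, x, by simp⟩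
      | succ j ih =>
        intro x
        obtain ⟨f, y, hy⟩ := ih x
        obtain ⟨z, hz⟩ := hres (y - s (truncResidue R hn y)) (by rw [map_sub, hs, sub_self])
        refine ⟨f + X ^ j * C (truncResidue R hn y), z, ?_⟩
        rw [map_add, map_mul, map_pow, hevX, hevC, hy]
        linear_combination t ^ j * hz
    intro x
    obtain ⟨f, y, hy⟩ := key n x
    exact ⟨f, by rw [hy, htn, zero_mul, add_zero]⟩
  have hker : RingHom.ker ev = Ideal.span {(X : (ResidueField R)[X]) ^ n} := by
    ext f
    rw [RingHom.mem_ker, Ideal.mem_span_singleton]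
    constructor
    · intro hf
      by_contra hdvd
      have hf0 : f ≠ 0 := fun h ↦ hdvd (h ▸ dvd_zero _)
      -- With `f = X ^ j * g` and `g` of nonzero constant term, `ev g` lifts to a unit of `R`, so
      -- `ev f = 0` would force `π ^ n ∣ π ^ j` with `j < n`.
      obtain ⟨g, hg, hgX⟩ := exists_eq_pow_rootMultiplicity_mul_and_not_dvd f hf0 0
      rw [C_0, sub_zero] at hg hgX
      set j := rootMultiplicity 0 f
      have hj : j < n := by
        by_contra h
        exact hdvd (hg ▸ Dvd.dvd.mul_right (pow_dvd_pow X (not_lt.1 h)) g)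
      have hunit : truncResidue R hn (ev g) ≠ 0 := by
        obtain ⟨h, hh⟩ : X ∣ g - C (g.coeff 0) := by simp [X_dvd_iff]
        rw [X_dvd_iff] at hgX
        rw [sub_eq_iff_eq_add.1 hh, map_add, map_mul, hevX, hevC, map_add, map_mul, htres, hs,
          zero_mul, zero_add]
        exact hgX
      rw [hg, map_mul, map_pow, hevX] at hf
      obtain ⟨y, hy⟩ := Ideal.Quotient.mk_surjective (ev g)
      rw [← hy, truncResidue_mk, residue_ne_zero_iff_isUnit] at hunit
      rw [← hy, ht, ← map_pow, ← map_mul, Ideal.Quotient.eq_zero_iff_mem,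
        Ideal.mul_unit_mem_iff_mem _ hunit, hπ, Ideal.span_singleton_pow,
        Ideal.mem_span_singleton] at hf
      have hnu : ¬ IsUnit π := by
        rw [← mem_nonunits_iff, ← mem_maximalIdeal, hπ]
        exact Ideal.mem_span_singleton_self π
      exact absurd ((pow_dvd_pow_iff hπ0 hnu).1 hf) (not_le.2 hj)
    · rintro ⟨g, rfl⟩
      rw [map_mul, map_pow, hevX, htn, zero_mul]
  exact ⟨(RingHom.quotientKerEquivOfSurjective hsurj).symm.trans (Ideal.quotEquivOfEq hker)⟩

/-- Truncations in equal characteristic with uniformizer and the same perfect residue field are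
isomorphic. -/
theorem nonempty_trunc_equiv_trunc {R S : Type*} [CommRing R] [IsDomain R] [IsLocalRing R]
    [CommRing S] [IsDomain S] [IsLocalRing S] {n p : ℕ}
    (hp : p.Prime) (hn : n ≠ 0) (hpR : (p : R) ∈ maximalIdeal R ^ n)
    (hpS : (p : S) ∈ maximalIdeal S ^ n)
    [CharP (ResidueField R) p] [PerfectField (ResidueField R)]
    (σ : ResidueField R ≃+* ResidueField S) {π : R} (hπ0 : π ≠ 0)
    (hπ : maximalIdeal R = Ideal.span {π}) {ϖ : S} (hϖ0 : ϖ ≠ 0)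
    (hϖ : maximalIdeal S = Ideal.span {ϖ}) :
    Nonempty ((R ⧸ maximalIdeal R ^ n) ≃+* S ⧸ maximalIdeal S ^ n) := by
  have : CharP (ResidueField S) p :=
    charP_of_injective_ringHom (f := (σ : ResidueField R →+* ResidueField S)) σ.injective p
  have : PerfectField (ResidueField S) := by
    have : Fact p.Prime := ⟨hp⟩
    have : PerfectRing (ResidueField R) p := PerfectField.toPerfectRing p
    have : PerfectRing (ResidueField S) p := by
      refine PerfectRing.ofSurjective _ p fun y ↦ ?_
      obtain ⟨x, hx⟩ := surjective_frobenius (ResidueField R) p (σ.symm y)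
      exact ⟨σ x, by rw [← σ.apply_symm_apply y, ← hx, frobenius_def, frobenius_def, map_pow]⟩
    exact PerfectRing.toPerfectField _ p
  obtain ⟨f⟩ := nonempty_trunc_equiv hp hn hpR hπ0 hπ
  obtain ⟨g⟩ := nonempty_trunc_equiv hp hn hpS hϖ0 hϖ
  refine ⟨f.trans ((Ideal.quotientEquiv _ _ (mapEquiv σ) ?_).trans g.symm)⟩
  rw [Ideal.map_span]
  simp

/-! ### Henselian rings and adic completeness -/

theorem henselianLocalRing_of_ringEquiv {R S : Type*} [CommRing R] [CommRing S]
    [hR : HenselianLocalRing R] (σ : R ≃+* S) : HenselianLocalRing S := by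
  have : IsLocalRing S := σ.isLocalRing
  refine ⟨fun f hf a h₁ h₂ ↦ ?_⟩
  have hmax (x : R) : σ x ∈ maximalIdeal S ↔ x ∈ maximalIdeal R := by
    simp [mem_maximalIdeal, mem_nonunits_iff]
  have hev (g : S[X]) (b : R) : σ ((g.map (σ.symm : S →+* R)).eval b) = g.eval (σ b) := by
    rw [eval_map, ← RingEquiv.coe_toRingHom, hom_eval₂]
    simp only [RingEquiv.comp_symm, eval₂_eq_eval_map, map_id, RingEquiv.coe_toRingHom]
  obtain ⟨b, rfl⟩ := σ.surjective a
  obtain ⟨c, hc, hcb⟩ := hR.is_henselian (f.map (σ.symm : S →+* R)) (hf.map _) b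
    (by rwa [← hmax, hev]) (by
      rw [← isUnit_map_iff σ, derivative_map, hev]; exact h₂)
  refine ⟨σ c, ?_, ?_⟩
  · rw [IsRoot, ← hev, hc, map_zero]
  · rwa [← map_sub, hmax]

theorem henselianLocalRing_of_isAdicComplete {R : Type*} [CommRing R] [IsLocalRing R]
    [IsAdicComplete (maximalIdeal R) R] : HenselianLocalRing R where
  is_henselian f hf a h₁ h₂ :=
    HenselianRing.is_henselian (I := maximalIdeal R) f hf a h₁ (h₂.map _)

/-- The powers of `I ^ e` are cofinal among those of `I`: the subsequence `f (e * n)` of a Cauchy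
sequence has a limit, which is also the limit of `f`. -/
theorem isAdicComplete_of_pow {R : Type*} [CommRing R] (I : Ideal R) {e : ℕ} (he : e ≠ 0)
    [IsAdicComplete (I ^ e) R] : IsAdicComplete I R where
  haus' x h := IsHausdorff.haus' (I := I ^ e) x fun n ↦ by
    rw [← pow_mul]; exact h _
  prec' f h := by
    have hle (n : ℕ) : n ≤ e * n := Nat.le_mul_of_pos_left n (Nat.pos_of_ne_zero he)
    obtain ⟨L, hL⟩ := IsPrecomplete.prec' (I := I ^ e) (fun n ↦ f (e * n)) (fun {m n} hmn ↦ by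
      rw [← pow_mul]; exact h (Nat.mul_le_mul_left e hmn))
    refine ⟨L, fun n ↦ (h (hle n)).trans ((hL n).mono ?_)⟩
    rw [← pow_mul]
    exact Submodule.smul_mono_left (Ideal.pow_le_pow_right (hle n))

/-! ### Ordered groups with a least positive element -/

section OrderedGroup

variable {Γ : Type*} [AddCommGroup Γ] [LinearOrder Γ] [IsOrderedAddMonoid Γ]

theorem exists_eq_nsmul_of_lt_nsmul {γ : Γ} (hmin : ∀ δ, 0 < δ → γ ≤ δ) (j : ℕ) {δ : Γ}
    (h0 : 0 ≤ δ) (hδ : δ < j • γ) : ∃ i < j, δ = i • γ := by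
  induction j generalizing δ with
  | zero => exact absurd hδ (by simpa using h0)
  | succ j ih =>
    rcases h0.eq_or_lt with rfl | h0
    · exact ⟨0, j.succ_pos, by simp⟩
    · obtain ⟨i, hi, hi'⟩ := ih (sub_nonneg.2 (hmin δ h0))
        (by rwa [sub_lt_iff_lt_add, ← succ_nsmul])
      exact ⟨i + 1, by omega, by rw [succ_nsmul, ← hi', sub_add_cancel]⟩

theorem encard_pos_le_nsmul {γ : Γ} (hγ : 0 < γ) (hmin : ∀ δ, 0 < δ → γ ≤ δ) (e : ℕ) :
    {δ : Γ | 0 < δ ∧ δ ≤ e • γ}.encard = e := by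
  have h : {δ : Γ | 0 < δ ∧ δ ≤ e • γ} = (fun i : ℕ ↦ i • γ) '' Set.Icc 1 e := by
    ext δ
    constructor
    · rintro ⟨h0, h1⟩
      obtain ⟨i, hi, rfl⟩ := exists_eq_nsmul_of_lt_nsmul hmin (e + 1) h0.le
        (h1.trans_lt (nsmul_lt_nsmul_left hγ e.lt_succ_self))
      refine ⟨i, ⟨Nat.one_le_iff_ne_zero.2 ?_, by omega⟩, rfl⟩
      rintro rfl
      simp at h0
    · rintro ⟨i, ⟨hi1, hie⟩, rfl⟩
      exact ⟨nsmul_pos hγ (by omega), nsmul_le_nsmul_left hγ.le hie⟩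
  rw [h, (nsmul_left_strictMono hγ).injective.encard_image, ← Finset.coe_Icc,
    Set.encard_coe_eq_coe_finsetCard]
  simp

theorem exists_least_pos_of_encard {g : Γ} {e : ℕ} (he : e ≠ 0)
    (h : {δ : Γ | 0 < δ ∧ δ ≤ g}.encard = e) :
    ∃ γ : Γ, 0 < γ ∧ (∀ δ, 0 < δ → γ ≤ δ) ∧ g = e • γ := by
  have hne : {δ : Γ | 0 < δ ∧ δ ≤ g}.Nonempty := by
    rw [← Set.encard_ne_zero, h]
    exact_mod_cast he
  obtain ⟨γ, ⟨hγ0, hγg⟩, hγ⟩ :=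
    Set.exists_min_image _ id (Set.finite_of_encard_eq_coe h) hne
  have hmin : ∀ δ, 0 < δ → γ ≤ δ := fun δ hδ ↦
    (le_total δ g).elim (fun hg ↦ hγ δ ⟨hδ, hg⟩) fun hg ↦ hγg.trans hg
  -- Otherwise `γ, 2γ, …, (e + 1)γ` would be too many elements in the interval.
  have hlt : g < (e + 1) • γ := by
    by_contra! hle
    have hsub : {δ : Γ | 0 < δ ∧ δ ≤ (e + 1) • γ} ⊆ {δ : Γ | 0 < δ ∧ δ ≤ g} :=
      fun δ hδ ↦ ⟨hδ.1, hδ.2.trans hle⟩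
    have := Set.encard_le_encard hsub
    rw [h, encard_pos_le_nsmul hγ0 hmin] at this
    exact absurd (by exact_mod_cast this) e.lt_succ_self.not_ge
  obtain ⟨i, -, rfl⟩ := exists_eq_nsmul_of_lt_nsmul hmin _ (hγ0.le.trans hγg) hlt
  rw [encard_pos_le_nsmul hγ0 hmin] at h
  exact ⟨γ, hγ0, hmin, by rw [Nat.cast_inj.1 h]⟩

end OrderedGroup

/-! ### Uniformizers of finitely ramified valued fields -/

section ValRing

variable {K : Type u} [Field K] {Γ : Type v} [AddCommGroup Γ] [LinearOrder Γ]
  [IsOrderedAddMonoid Γ] (ν : AddValuation K (WithTop Γ))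

theorem valRing_dvd_iff {a b : valRing ν} (ha : a ≠ 0) : a ∣ b ↔ ν (a : K) ≤ ν (b : K) := by
  have ha' : (a : K) ≠ 0 := by exact_mod_cast ha
  constructor
  · rintro ⟨c, rfl⟩
    rw [MulMemClass.coe_mul, AddValuation.map_mul]
    exact le_add_of_nonneg_right ((mem_valRing ν _).1 c.2)
  · intro h
    have hmul : (a : K) * (b / a) = b := mul_div_cancel₀ _ ha'
    refine ⟨⟨b / a, (mem_valRing ν _).2 ?_⟩, Subtype.ext hmul.symm⟩
    rw [← hmul, AddValuation.map_mul] at h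
    have hfin : ν (a : K) ≠ ⊤ := by rwa [Ne, AddValuation.top_iff]
    revert h
    generalize ν ((b : K) / a) = y
    lift ν (a : K) to Γ using hfin with x
    induction y with
    | top => exact fun _ ↦ le_top
    | coe y =>
      intro h
      norm_cast at h ⊢
      exact nonneg_of_le_add_right h

theorem valRing_mem_maximalIdeal_iff {a : valRing ν} :
    a ∈ maximalIdeal (valRing ν) ↔ 0 < ν (a : K) := by
  rw [mem_maximalIdeal, mem_nonunits_iff]
  rcases eq_or_ne a 0 with rfl | ha
  · simp
  · rw [isUnit_iff_dvd_one, valRing_dvd_iff ν ha, OneMemClass.coe_one, AddValuation.map_one, not_le]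

/-- A valued field of positive finite absolute ramification index `e` has a uniformizer, and its
`e`-th power generates the same ideal as the residue characteristic. -/
theorem exists_uniformizer {p e : ℕ} (he : e ≠ 0) (hν : IsHenselianMixedChar ν)
    (hchar : CharP (ResField ν) p) (hram : absRamificationIndex ν = e) :
    ∃ π : valRing ν, π ≠ 0 ∧ maximalIdeal (valRing ν) = Ideal.span {π} ∧
      Associated ((p : ℕ) : valRing ν) (π ^ e) := by
  have := hν.charZero
  obtain rfl := ringChar.eq (ResField ν) p
  have hp0 : ((ringChar (ResField ν) : ℕ) : K) ≠ 0 := Nat.cast_ne_zero.2 hν.residueChar.ne_zero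
  have hp0' : ((ringChar (ResField ν) : ℕ) : valRing ν) ≠ 0 := by
    intro h
    exact hp0 (by exact_mod_cast congrArg (Subtype.val) h)
  have hfin : ν ((ringChar (ResField ν) : ℕ) : K) ≠ ⊤ := by rwa [Ne, AddValuation.top_iff]
  obtain ⟨g, hg⟩ := WithTop.ne_top_iff_exists.1 hfin
  simp only [absRamificationIndex, ← hg, WithTop.coe_le_coe] at hram
  obtain ⟨γ, hγ0, hmin, rfl⟩ := exists_least_pos_of_encard he hram
  obtain ⟨x, hx⟩ := hν.surjective γ
  have hxR : x ∈ valRing ν := by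
    rw [mem_valRing, hx]
    exact_mod_cast hγ0.le
  have hx0 : x ≠ 0 := by
    rintro rfl
    simp at hx
  have hπ0 : (⟨x, hxR⟩ : valRing ν) ≠ 0 := fun h ↦ hx0 (congrArg Subtype.val h)
  refine ⟨⟨x, hxR⟩, hπ0, ?_, ?_⟩
  · ext a
    rw [valRing_mem_maximalIdeal_iff, Ideal.mem_span_singleton, valRing_dvd_iff ν hπ0]
    change _ ↔ ν x ≤ _
    rw [hx]
    generalize ν (a : K) = y
    induction y with
    | top => simp
    | coe y =>
      norm_cast
      exact ⟨hmin y, hγ0.trans_le⟩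
  · have hpow : ν (((⟨x, hxR⟩ : valRing ν) ^ e : valRing ν) : K) =
        ν (((ringChar (ResField ν) : ℕ) : valRing ν) : K) := by
      change ν (x ^ e) = ν ((ringChar (ResField ν) : ℕ) : K)
      rw [AddValuation.map_pow, hx, ← hg]
      norm_cast
    exact associated_of_dvd_dvd ((valRing_dvd_iff ν hp0').2 hpow.ge)
      ((valRing_dvd_iff ν (pow_ne_zero e hπ0)).2 hpow.le)

end ValRing

/-! ### Eisenstein extensions of complete discrete valuation rings -/

/-- For finite modules over a Noetherian ring, completion is tensoring with the completed ring, and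
here that ring is `A` itself. -/
theorem isAdicComplete_of_moduleFinite {A M : Type u} [CommRing A] [IsNoetherianRing A]
    (I : Ideal A) [IsAdicComplete I A] [AddCommGroup M] [Module A M] [Module.Finite A M] :
    IsAdicComplete I M := by
  rw [← AdicCompletion.of_bijective_iff]
  let o : A ≃ₗ[A] AdicCompletion I A :=
    LinearEquiv.ofBijective (AdicCompletion.of I A) (AdicCompletion.of_bijective I A)
  let g := (TensorProduct.lid A M).symm.trans (TensorProduct.congr o (LinearEquiv.refl A M))
  have hg : ⇑(AdicCompletion.of I M) = AdicCompletion.ofTensorProduct I M ∘ g := by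
    ext1 x
    change _ = AdicCompletion.ofTensorProduct I M (AdicCompletion.of I A 1 ⊗ₜ[A] x)
    rw [AdicCompletion.ofTensorProduct_tmul]
    exact (one_smul (AdicCompletion I A) _).symm
  rw [hg]
  exact (AdicCompletion.ofTensorProduct_bijective_of_finite_of_isNoetherian I M).comp g.bijective

/-- The Eisenstein polynomial `X ^ e + a ϖ X - ϖ`. -/
noncomputable def eisensteinTrinomial {A : Type*} [CommRing A] (ϖ a : A) (e : ℕ) : A[X] :=
  X ^ e + (C (a * ϖ) * X - C ϖ)

theorem aeval_eisensteinTrinomial {A B : Type*} [CommRing A] [CommRing B] [Algebra A B] (ϖ a : A)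
    (e : ℕ) (x : B) : aeval x (eisensteinTrinomial ϖ a e) =
      x ^ e + (algebraMap A B a * algebraMap A B ϖ * x - algebraMap A B ϖ) := by
  simp [eisensteinTrinomial]

section Trinomial

variable {A : Type u} [CommRing A] [IsDomain A] (ϖ a : A) {e : ℕ} (he : 2 ≤ e)

include he

omit [IsDomain A] in
theorem degree_trinomial_tail_lt : (C (a * ϖ) * X - C ϖ : A[X]).degree < e := by
  rw [sub_eq_add_neg, ← C_neg]
  exact degree_linear_le.trans_lt (by exact_mod_cast he)

omit [IsDomain A] in
theorem monic_eisensteinTrinomial : (eisensteinTrinomial ϖ a e).Monic :=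
  monic_X_pow_add (degree_trinomial_tail_lt ϖ a he)

theorem natDegree_eisensteinTrinomial : (eisensteinTrinomial ϖ a e).natDegree = e :=
  (natDegree_add_eq_left_of_degree_lt
    ((degree_trinomial_tail_lt ϖ a he).trans_eq (degree_X_pow e).symm)).trans (natDegree_X_pow e)

theorem prime_eisensteinTrinomial [UniqueFactorizationMonoid A] {ϖ : A} (hϖ : Prime ϖ) :
    Prime (eisensteinTrinomial ϖ a e) := by
  rw [← UniqueFactorizationMonoid.irreducible_iff_prime]
  have hm := monic_eisensteinTrinomial ϖ a he
  have hd := natDegree_eisensteinTrinomial ϖ a he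
  have hI : (Ideal.span {ϖ}).IsPrime := (Ideal.span_singleton_prime hϖ.ne_zero).2 hϖ
  refine (hm.isEisensteinAt_of_mem_of_notMem hI.ne_top ?_ ?_).irreducible hI hm.isPrimitive
    (by omega)
  · intro n hn
    rw [hd] at hn
    rw [Ideal.mem_span_singleton, eisensteinTrinomial, coeff_add, coeff_X_pow, if_neg hn.ne,
      zero_add, coeff_sub, coeff_C_mul, coeff_C]
    refine dvd_sub ((dvd_mul_left ϖ a).mul_right _) ?_
    split_ifs
    exacts [dvd_rfl, dvd_zero _]
  · rw [Ideal.span_singleton_pow, Ideal.mem_span_singleton, eisensteinTrinomial, coeff_add,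
      coeff_X_pow, if_neg (by omega), zero_add, coeff_sub, coeff_C_mul, coeff_C, coeff_X_zero]
    rw [mul_zero, zero_sub, if_pos rfl, dvd_neg, pow_two]
    intro h
    exact hϖ.not_isUnit (isUnit_of_dvd_one ((mul_dvd_mul_iff_left hϖ.ne_zero).1 (by simpa using h)))

end Trinomial

/-- The Eisenstein extension of `A` by a root of `X ^ e + a ϖ X - ϖ`. -/
abbrev EisensteinExt {A : Type*} [CommRing A] (ϖ a : A) (e : ℕ) : Type _ :=
  AdjoinRoot (eisensteinTrinomial ϖ a e)

namespace EisensteinExt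

section General

variable {A : Type u} [CommRing A] (ϖ a : A) (e : ℕ)

/-- The distinguished root of the Eisenstein polynomial. -/
noncomputable def root : EisensteinExt ϖ a e := AdjoinRoot.root _

/-- This form of the equation serves both choices of `a`: for `a = 0` it makes `ϖ` an `e`-th power,
for `a = 1` it twists `ϖ` by `1 - π`. -/
theorem root_pow : root ϖ a e ^ e =
    algebraMap A _ ϖ * (1 - algebraMap A (EisensteinExt ϖ a e) a * root ϖ a e) := by
  have h : aeval (root ϖ a e) (eisensteinTrinomial ϖ a e) = 0 := AdjoinRoot.eval₂_root _
  rw [aeval_eisensteinTrinomial] at h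
  linear_combination h

theorem exists_eq_algebraMap_add (x : EisensteinExt ϖ a e) :
    ∃ c y, x = algebraMap A _ c + root ϖ a e * y := by
  obtain ⟨g, rfl⟩ := AdjoinRoot.mk_surjective x
  refine ⟨g.coeff 0, AdjoinRoot.mk _ g.divX, ?_⟩
  conv_lhs => rw [← divX_mul_X_add g]
  rw [map_add, map_mul, AdjoinRoot.mk_X, AdjoinRoot.mk_C, AdjoinRoot.algebraMap_eq, root]
  ring

variable [IsDomain A] {e} (he : 2 ≤ e)

include he

theorem algebraMap_injective : Function.Injective (algebraMap A (EisensteinExt ϖ a e)) := by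
  refine AdjoinRoot.of.injective_of_degree_ne_zero fun h ↦ ?_
  have := natDegree_eq_zero_iff_degree_le_zero.2 h.le
  rw [natDegree_eisensteinTrinomial ϖ a he] at this
  omega

omit [IsDomain A] in
theorem moduleFinite : Module.Finite A (EisensteinExt ϖ a e) :=
  (monic_eisensteinTrinomial ϖ a he).finite_adjoinRoot

end General

section DVR

variable {A : Type u} [CommRing A] [IsDomain A] [IsDiscreteValuationRing A] {ϖ : A}
  (hϖ : Irreducible ϖ) (a : A) {e : ℕ}

include hϖ

theorem isDomain (he : 2 ≤ e) : IsDomain (EisensteinExt ϖ a e) :=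
  AdjoinRoot.isDomain_of_prime (prime_eisensteinTrinomial a he hϖ.prime)

/-- Reduction modulo the distinguished root. -/
noncomputable def reduction (he : 2 ≤ e) : EisensteinExt ϖ a e →+* ResidueField A :=
  AdjoinRoot.lift (residue A) 0 (by
    have : residue A ϖ = 0 := by
      rw [residue_eq_zero_iff, hϖ.maximalIdeal_eq]
      exact Ideal.mem_span_singleton_self ϖ
    simp [eisensteinTrinomial, this, show e ≠ 0 by omega])

theorem reduction_root (he : 2 ≤ e) : reduction hϖ a he (root ϖ a e) = 0 := AdjoinRoot.lift_root _

theorem reduction_algebraMap (he : 2 ≤ e) (c : A) :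
    reduction hϖ a he (algebraMap A _ c) = residue A c :=
  AdjoinRoot.lift_of _

theorem reduction_surjective (he : 2 ≤ e) : Function.Surjective (reduction hϖ a he) := fun y ↦ by
  obtain ⟨c, rfl⟩ := residue_surjective y
  exact ⟨_, reduction_algebraMap hϖ a he c⟩

omit [IsDomain A] [IsDiscreteValuationRing A] hϖ in
theorem algebraMap_mem_span_root (he : 2 ≤ e) :
    algebraMap A _ ϖ ∈ Ideal.span {root ϖ a e} := by
  rw [Ideal.mem_span_singleton]
  refine ⟨root ϖ a e ^ (e - 1) + algebraMap A _ (a * ϖ), ?_⟩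
  rw [mul_add, ← pow_succ', Nat.sub_add_cancel (by omega), root_pow, map_mul]
  ring

theorem ker_reduction (he : 2 ≤ e) : RingHom.ker (reduction hϖ a he) = Ideal.span {root ϖ a e} := by
  refine le_antisymm (fun x hx ↦ ?_) ?_
  · obtain ⟨c, y, rfl⟩ := exists_eq_algebraMap_add ϖ a e x
    rw [RingHom.mem_ker, map_add, map_mul, reduction_root, zero_mul, add_zero,
      reduction_algebraMap, residue_eq_zero_iff, hϖ.maximalIdeal_eq, Ideal.mem_span_singleton] at hx
    obtain ⟨d, rfl⟩ := hx
    rw [map_mul]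
    exact add_mem (Ideal.mul_mem_right _ _ (algebraMap_mem_span_root a he))
      (Ideal.mul_mem_right _ _ (Ideal.mem_span_singleton_self _))
  · rw [Ideal.span_singleton_le_iff_mem]
    exact reduction_root hϖ a he

theorem span_root_isMaximal (he : 2 ≤ e) : (Ideal.span {root ϖ a e}).IsMaximal := by
  rw [← ker_reduction hϖ a he]
  exact RingHom.ker_isMaximal_of_surjective _ (reduction_surjective hϖ a he)

omit [IsDiscreteValuationRing A] in
theorem root_ne_zero (he : 2 ≤ e) : root ϖ a e ≠ 0 := by
  intro h
  have h' := algebraMap_mem_span_root (ϖ := ϖ) a he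
  rw [h, Ideal.mem_span_singleton, zero_dvd_iff,
    map_eq_zero_iff _ (algebraMap_injective ϖ a he)] at h'
  exact hϖ.ne_zero h'

variable [IsAdicComplete (Ideal.span {ϖ}) A]

omit hϖ in
theorem isAdicComplete_span_algebraMap (he : 2 ≤ e) :
    IsAdicComplete (Ideal.span {algebraMap A (EisensteinExt ϖ a e) ϖ}) (EisensteinExt ϖ a e) := by
  have := moduleFinite ϖ a he
  have := isAdicComplete_of_moduleFinite (M := EisensteinExt ϖ a e) (Ideal.span {ϖ})
  rwa [← IsAdicComplete.map_algebraMap_iff (S := EisensteinExt ϖ a e), Ideal.map_span,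
    Set.image_singleton] at this

/-- By completeness `ϖ` lies in the Jacobson radical. Since the `e`-th power of the root is a
multiple of `ϖ`, every maximal ideal contains the root, which already generates a maximal ideal. -/
theorem isLocalRing (he : 2 ≤ e) : IsLocalRing (EisensteinExt ϖ a e) := by
  refine IsLocalRing.of_unique_max_ideal
    ⟨_, span_root_isMaximal hϖ a he, fun M (hM : M.IsMaximal) ↦ ?_⟩
  have := isAdicComplete_span_algebraMap (ϖ := ϖ) a he
  have hmem : algebraMap A _ ϖ ∈ M := by
    have h := IsAdicComplete.le_jacobson_bot (Ideal.span {algebraMap A (EisensteinExt ϖ a e) ϖ})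
      (Ideal.mem_span_singleton_self _)
    exact Ideal.mem_sInf.1 h ⟨bot_le, hM⟩
  have hroot : root ϖ a e ∈ M := by
    refine hM.isPrime.mem_of_pow_mem e ?_
    rw [root_pow]
    exact Ideal.mul_mem_right _ _ hmem
  exact ((span_root_isMaximal hϖ a he).eq_of_le hM.ne_top
    ((Ideal.span_singleton_le_iff_mem _).2 hroot)).symm

omit [IsAdicComplete (Ideal.span {ϖ}) A] in
theorem maximalIdeal_eq [IsLocalRing (EisensteinExt ϖ a e)] (he : 2 ≤ e) :
    maximalIdeal (EisensteinExt ϖ a e) = Ideal.span {root ϖ a e} :=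
  (eq_maximalIdeal (span_root_isMaximal hϖ a he)).symm

omit [IsAdicComplete (Ideal.span {ϖ}) A] in
theorem associated_root_pow [IsLocalRing (EisensteinExt ϖ a e)] (he : 2 ≤ e) :
    Associated (algebraMap A (EisensteinExt ϖ a e) ϖ) (root ϖ a e ^ e) := by
  have hu : IsUnit (1 - algebraMap A (EisensteinExt ϖ a e) a * root ϖ a e) := by
    refine (isUnit_or_isUnit_one_sub_self (algebraMap A _ a * root ϖ a e)).resolve_left ?_
    rw [← mem_nonunits_iff, ← mem_maximalIdeal, maximalIdeal_eq hϖ a he]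
    exact Ideal.mul_mem_left _ _ (Ideal.mem_span_singleton_self _)
  rw [root_pow]
  exact ⟨hu.unit, rfl⟩

/-- The extension is finite, hence `ϖ`-adically complete, and `(ϖ)` is the `e`-th power of the
maximal ideal. -/
theorem isAdicComplete [IsLocalRing (EisensteinExt ϖ a e)] (he : 2 ≤ e) :
    IsAdicComplete (maximalIdeal (EisensteinExt ϖ a e)) (EisensteinExt ϖ a e) := by
  have := isDomain hϖ a he
  have := isAdicComplete_span_algebraMap (ϖ := ϖ) a he
  rw [Ideal.span_singleton_eq_span_singleton.2 (associated_root_pow hϖ a he),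
    ← Ideal.span_singleton_pow, ← maximalIdeal_eq hϖ a he] at this
  exact isAdicComplete_of_pow _ (e := e) (by omega)

theorem isDiscreteValuationRing [IsDomain (EisensteinExt ϖ a e)] (he : 2 ≤ e) :
    IsDiscreteValuationRing (EisensteinExt ϖ a e) := by
  have := isLocalRing hϖ a he
  have hm := maximalIdeal_eq hϖ a he
  have hf : ¬ IsField (EisensteinExt ϖ a e) := by
    rw [isField_iff_maximalIdeal_eq, hm, Ideal.span_singleton_eq_bot]
    exact root_ne_zero hϖ a he
  have h : IsDiscreteValuationRing (EisensteinExt ϖ a e) ↔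
      (maximalIdeal (EisensteinExt ϖ a e)).IsPrincipal :=
    (IsDiscreteValuationRing.TFAE (EisensteinExt ϖ a e) hf).out 0 4
  exact h.2 ⟨_, hm⟩

/-- The Eisenstein extension is totally ramified. -/
noncomputable def residueFieldEquiv [IsLocalRing (EisensteinExt ϖ a e)] (he : 2 ≤ e) :
    ResidueField (EisensteinExt ϖ a e) ≃+* ResidueField A :=
  (Ideal.quotEquivOfEq ((maximalIdeal_eq hϖ a he).trans (ker_reduction hϖ a he).symm)).trans
    (RingHom.quotientKerEquivOfSurjective (reduction_surjective hϖ a he))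

end DVR

end EisensteinExt

/-! ### The wild obstruction to `e`-th roots -/

/-- If `p` divides `e` and `p ∈ (π ^ 2)`, then `π ^ e / (1 - π)` has no `e`-th root. -/
theorem pow_mul_one_sub_ne_pow {R : Type*} [CommRing R] [IsDomain R] {p e : ℕ} (hp : p.Prime)
    (hpe : p ∣ e) (he : e ≠ 0) {π : R} (hπ : Prime π) (h2 : π ^ 2 ∣ (p : R)) (x : R) :
    x ^ e * (1 - π) ≠ π ^ e := by
  intro h
  have hx : π ∣ x := by
    have : π ∣ x ^ e * (1 - π) := h ▸ dvd_pow_self π he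
    refine hπ.dvd_of_dvd_pow ((hπ.dvd_or_dvd this).resolve_right fun h1 ↦ hπ.not_dvd_one ?_)
    simpa using dvd_add h1 (dvd_refl π)
  obtain ⟨y, rfl⟩ := hx
  obtain ⟨d, rfl⟩ := hpe
  rw [mul_pow, mul_assoc, mul_eq_left₀ (pow_ne_zero _ hπ.ne_zero), mul_comm p d, pow_mul] at h
  -- After cancelling `π ^ e`, the equation reads `w ^ p * (1 - π) = 1`, so `w ^ p - 1 = w ^ p * π`.
  set w := y ^ d
  have hp2 : π ∣ (p : R) := (dvd_pow_self π two_ne_zero).trans h2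
  obtain ⟨r, hr⟩ := exists_add_pow_prime_eq hp (w - 1) 1
  rw [sub_add_cancel] at hr
  -- Modulo `p`, hence modulo `π`, `(w - 1) ^ p` agrees with `w ^ p - 1`, which `π` divides.
  have hw : π ∣ w - 1 := by
    refine hπ.dvd_of_dvd_pow (n := p) ?_
    obtain ⟨q, hq⟩ := hp2
    refine ⟨w ^ p - q * (w - 1) * r, ?_⟩
    rw [hq] at hr
    linear_combination h - hr
  have hw2 : π ^ 2 ∣ w ^ p - 1 := by
    obtain ⟨q, hq⟩ := h2
    obtain ⟨z, hz⟩ := (pow_dvd_pow_of_dvd hw 2).trans (pow_dvd_pow (w - 1) hp.two_le)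
    refine ⟨z + q * (w - 1) * r, ?_⟩
    rw [hr, hz, hq]
    ring
  obtain ⟨z, hz⟩ := hw2
  -- Multiplying `w ^ p - 1 = π ^ 2 * z` by `1 - π` gives `π = π ^ 2 * z * (1 - π)`.
  refine hπ.not_dvd_one ⟨z * (1 - π), mul_left_cancel₀ hπ.ne_zero ?_⟩
  linear_combination (1 - π) * hz - h

/-! ### Discrete valuation rings as valued fields -/

instance isOrderedAddMonoid_uliftInt : IsOrderedAddMonoid (ULift.{v} ℤ) where
  add_le_add_left _ _ h c := ULift.down_le.1 (add_le_add_left (ULift.down_le.2 h) c.down)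

section DVRValuation

variable (O : Type*) (K : Type u) [CommRing O] [IsDomain O] [IsDiscreteValuationRing O] [Field K]
  [Algebra O K] [IsFractionRing O K]

open scoped WithZero in
/-- The normalized additive valuation on the fraction field of a discrete valuation ring, with
values in a copy of `ℤ` in an arbitrary universe. -/
noncomputable def dvrAddVal : AddValuation K (WithTop (ULift.{v} ℤ)) :=
  let w := (IsDiscreteValuationRing.maximalIdeal O).valuation K
  open Classical in
  AddValuation.of (fun x ↦ if x = 0 then ⊤ else ((ULift.up (-WithZero.log (w x)) : ULift.{v} ℤ) :
      WithTop (ULift.{v} ℤ)))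
    (if_pos rfl)
    (by
      rw [if_neg one_ne_zero, map_one, WithZero.log_one]
      rfl)
    (by
      intro x y
      by_cases hx : x = 0
      · rw [if_pos hx, hx, zero_add]
        exact min_le_right _ _
      by_cases hy : y = 0
      · rw [if_pos hy, hy, add_zero]
        exact min_le_left _ _
      by_cases hxy : x + y = 0
      · simp [hxy]
      rw [if_neg hx, if_neg hy, if_neg hxy, ← WithTop.coe_min, WithTop.coe_le_coe, min_le_iff]
      have hx' : w x ≠ 0 := (Valuation.ne_zero_iff w).2 hx
      have hy' : w y ≠ 0 := (Valuation.ne_zero_iff w).2 hy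
      have hxy' : w (x + y) ≠ 0 := (Valuation.ne_zero_iff w).2 hxy
      rcases le_max_iff.1 (w.map_add x y) with h | h
      · exact Or.inl (ULift.down_le.1 (neg_le_neg ((WithZero.log_le_log hxy' hx').2 h)))
      · exact Or.inr (ULift.down_le.1 (neg_le_neg ((WithZero.log_le_log hxy' hy').2 h))))
    (by
      intro x y
      by_cases hx : x = 0
      · simp [hx]
      by_cases hy : y = 0
      · simp [hy]
      have hx' : w x ≠ 0 := (Valuation.ne_zero_iff w).2 hx
      have hy' : w y ≠ 0 := (Valuation.ne_zero_iff w).2 hy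
      rw [if_neg hx, if_neg hy, if_neg (mul_ne_zero hx hy), map_mul, WithZero.log_mul hx' hy',
        neg_add, ← WithTop.coe_add]
      rfl)

variable {K} in
theorem dvrAddVal_apply {x : K} (hx : x ≠ 0) : dvrAddVal.{u, v} O K x =
    ((ULift.up (-WithZero.log ((IsDiscreteValuationRing.maximalIdeal O).valuation K x)) :
      ULift.{v} ℤ) : WithTop (ULift.{v} ℤ)) := if_neg hx

theorem mem_valRing_dvrAddVal_iff {x : K} :
    x ∈ valRing (dvrAddVal.{u, v} O K) ↔ ∃ a : O, algebraMap O K a = x := by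
  rw [mem_valRing]
  by_cases hx : x = 0
  · subst hx
    simp
  have hx' : (IsDiscreteValuationRing.maximalIdeal O).valuation K x ≠ 0 :=
    (Valuation.ne_zero_iff _).2 hx
  rw [dvrAddVal_apply O hx]
  have h : (0 : WithTop (ULift.{v} ℤ)) = ((ULift.up 0 : ULift.{v} ℤ) : WithTop (ULift.{v} ℤ)) := rfl
  rw [h, WithTop.coe_le_coe, ← ULift.down_le]
  change 0 ≤ -WithZero.log _ ↔ _
  rw [neg_nonneg, ← WithZero.log_one, WithZero.log_le_log hx' one_ne_zero]
  refine ⟨IsDiscreteValuationRing.exists_lift_of_le_one, ?_⟩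
  rintro ⟨a, rfl⟩
  exact IsDedekindDomain.HeightOneSpectrum.valuation_le_one _ a

/-- A discrete valuation ring is the valuation ring of its normalized valuation. -/
noncomputable def valRingDVREquiv : O ≃+* valRing (dvrAddVal.{u, v} O K) :=
  RingEquiv.ofBijective ((algebraMap O K).codRestrict (valRing (dvrAddVal.{u, v} O K)) fun a ↦
      (mem_valRing_dvrAddVal_iff O K).2 ⟨a, rfl⟩)
    ⟨fun _ _ h ↦ IsFractionRing.injective O K (congrArg Subtype.val h), fun x ↦ by
      obtain ⟨a, ha⟩ := (mem_valRing_dvrAddVal_iff O K).1 x.2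
      exact ⟨a, Subtype.ext ha⟩⟩

theorem dvrAddVal_algebraMap {π a : O} (hπ : Irreducible π) {n : ℕ}
    (ha : Associated a (π ^ n)) :
    dvrAddVal.{u, v} O K (algebraMap O K a) =
      ((n • (ULift.up 1) : ULift.{v} ℤ) : WithTop (ULift.{v} ℤ)) := by
  have ha0 : a ≠ 0 := fun h ↦ pow_ne_zero n hπ.ne_zero ((h ▸ ha).eq_zero_iff.1 rfl)
  have ha0' : algebraMap O K a ≠ 0 := by simpa using ha0
  obtain ⟨u, rfl⟩ := ha.symm
  rw [dvrAddVal_apply O ha0', IsDedekindDomain.HeightOneSpectrum.valuation_of_algebraMap,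
    IsDiscreteValuationRing.intValuation_maximalIdeal, mul_comm,
    IsDiscreteValuationRing.addVal_def' u hπ n]
  refine congrArg _ (ULift.ext _ _ ?_)
  change -WithZero.log (WithZero.exp (n : ℤ))⁻¹ = _
  rw [WithZero.log_inv, WithZero.log_exp, neg_neg, ULift.smul_down]
  simp

theorem isHenselianMixedChar_dvrAddVal [HenselianLocalRing O] [CharZero O] {p : ℕ} (hp : p.Prime)
    [CharP (ResidueField O) p] : IsHenselianMixedChar (dvrAddVal.{u, v} O K) where
  surjective γ := by
    obtain ⟨x, hx⟩ := (IsDiscreteValuationRing.maximalIdeal O).valuation_surjective K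
      (WithZero.exp (-γ.down))
    have hx0 : x ≠ 0 := by
      rintro rfl
      rw [map_zero] at hx
      exact WithZero.exp_ne_zero hx.symm
    exact ⟨x, by rw [dvrAddVal_apply O hx0, hx, WithZero.log_exp, neg_neg]⟩
  henselian := henselianLocalRing_of_ringEquiv (valRingDVREquiv.{u, v} O K)
  charZero := charZero_of_injective_algebraMap (IsFractionRing.injective O K)
  residueChar := by
    have : CharP (ResField (dvrAddVal.{u, v} O K)) p :=
      charP_of_injective_ringHom (f := (ResidueField.mapEquiv (valRingDVREquiv.{u, v} O K) :
        ResidueField O →+* ResField (dvrAddVal.{u, v} O K))) (RingEquiv.injective _) p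
    rwa [ringChar.eq (ResField (dvrAddVal.{u, v} O K)) p]

theorem absRamificationIndex_dvrAddVal {p e : ℕ} [CharP (ResidueField O) p] {π : O}
    (hπ : Irreducible π) (he : Associated (p : O) (π ^ e)) :
    absRamificationIndex (dvrAddVal.{u, v} O K) = e := by
  have : CharP (ResField (dvrAddVal.{u, v} O K)) p :=
    charP_of_injective_ringHom (f := (ResidueField.mapEquiv (valRingDVREquiv.{u, v} O K) :
      ResidueField O →+* ResField (dvrAddVal.{u, v} O K))) (RingEquiv.injective _) p
  rw [absRamificationIndex, ringChar.eq (ResField (dvrAddVal.{u, v} O K)) p,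
    ← map_natCast (algebraMap O K), dvrAddVal_algebraMap O K hπ he]
  simp only [WithTop.coe_le_coe]
  exact encard_pos_le_nsmul (γ := (ULift.up 1 : ULift.{v} ℤ)) (ULift.down_lt.1 Int.one_pos)
    (fun δ (hδ : (0 : ℤ) < δ.down) ↦ (Int.add_one_le_of_lt hδ : (1 : ℤ) ≤ δ.down)) e

end DVRValuation

/-! ### First-order logic -/

open FirstOrder

theorem RingElemEquiv.of_ringEquiv {R S : Type*} [CommRing R] [CommRing S] (σ : R ≃+* S) :
    RingElemEquiv R S := by
  let _ := Ring.compatibleRingOfRing R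
  let _ := Ring.compatibleRingOfRing S
  exact Language.StrongHomClass.elementarilyEquivalent (Ring.languageEquivEquivRingEquiv.symm σ)

theorem IsOrderedZGroup.ordGroupElemEquiv_uliftInt {Γ : Type*} [AddCommGroup Γ] [LinearOrder Γ]
    [IsOrderedAddMonoid Γ] (h : IsOrderedZGroup Γ) : OrdGroupElemEquiv Γ (ULift.{v} ℤ) := by
  let _ := ordGroupStructure Γ
  let _ := ordGroupStructure ℤ
  let _ := ordGroupStructure (ULift.{v} ℤ)
  let σ : ordGroupLang.Equiv ℤ (ULift.{v} ℤ) :=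
    { Equiv.ulift.symm with
      map_fun' := fun f x ↦ by cases f <;> rfl
      map_rel' := fun r x ↦ by cases r; rfl }
  exact Language.ElementarilyEquivalent.trans h (Language.StrongHomClass.elementarilyEquivalent σ)

section Terms

/-- The term `x ^ n`. -/
noncomputable def powTerm {α : Type*} (t : Language.ring.Term α) : ℕ → Language.ring.Term α
  | 0 => 1
  | n + 1 => powTerm t n * t

/-- The numeral `n`. -/
noncomputable def natTerm (α : Type*) : ℕ → Language.ring.Term α
  | 0 => 0
  | n + 1 => natTerm α n + 1

theorem ringTermVal_powTerm {α R : Type*} [CommRing R] (t : Language.ring.Term α) (n : ℕ)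
    (x : α → R) : ringTermVal (powTerm t n) x = ringTermVal t x ^ n := by
  let _ := Ring.compatibleRingOfRing R
  induction n with
  | zero => exact (Ring.realize_one x).trans (pow_zero _).symm
  | succ n ih =>
    rw [pow_succ, ← ih]
    exact Ring.realize_mul _ _ x

theorem ringTermVal_natTerm {α R : Type*} [CommRing R] (n : ℕ)
    (x : α → R) : ringTermVal (natTerm α n) x = n := by
  let _ := Ring.compatibleRingOfRing R
  induction n with
  | zero => exact (Ring.realize_zero x).trans Nat.cast_zero.symm
  | succ n ih =>
    rw [Nat.cast_succ, ← ih]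
    refine (Ring.realize_add _ _ x).trans ?_
    rw [Ring.realize_one]
    rfl

/-- Negation in the language of valued fields. -/
def VFFormula.neg {a b c : ℕ} (φ : VFFormula a b c) : VFFormula a b c := .imp φ .falsum

/-- The sentence stating that `m` has no `e`-th root in the field. -/
noncomputable def noRootSentence (m e : ℕ) : VFSentence :=
  .allField (.neg (.fieldEq (powTerm (.var 0) e) (natTerm _ m)))

variable {K : Type u} [Field K] {Γ : Type v} [AddCommGroup Γ] [LinearOrder Γ]
  [IsOrderedAddMonoid Γ] (ν : AddValuation K (WithTop Γ))

theorem satisfies_neg_iff (φ : VFSentence) : Satisfies ν (VFFormula.neg φ) ↔ ¬ Satisfies ν φ :=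
  Iff.rfl

theorem satisfies_noRootSentence_iff (m e : ℕ) :
    Satisfies ν (noRootSentence m e) ↔ ∀ x : K, x ^ e ≠ m := by
  refine forall_congr' fun x ↦ not_congr ?_
  change ringTermVal _ _ = ringTermVal _ _ ↔ _
  rw [ringTermVal_powTerm, ringTermVal_natTerm]
  rfl

/-- `Th ν` is complete: it contains each sentence or its negation, so truth also transfers back from
a model. -/
theorem IsModel.satisfies_iff {K' : Type*} [Field K'] {Γ' : Type*} [AddCommGroup Γ']
    [LinearOrder Γ'] [IsOrderedAddMonoid Γ'] {ν : AddValuation K (WithTop Γ)}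
    {ν' : AddValuation K' (WithTop Γ')} (h : IsModel ν' (Th ν)) (φ : VFSentence) :
    Satisfies ν' φ ↔ Satisfies ν φ := by
  refine ⟨fun h' ↦ ?_, h φ⟩
  by_contra hφ
  exact (satisfies_neg_iff ν' φ).1 (h _ ((satisfies_neg_iff ν φ).2 hφ)) h'

end Terms

/-! ### The two comparison fields and the lower bound -/

/-- A prime characteristic of `R` would be inherited by the residue field, hence equal `p`,
contradicting `p ≠ 0` in `R`. -/
theorem charZero_of_charP_residueField {R : Type*} [CommRing R] [IsDomain R] [IsLocalRing R] {p : ℕ}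
    (hp : p.Prime) [CharP (ResidueField R) p] (h0 : (p : R) ≠ 0) : CharZero R := by
  obtain ⟨q, hq⟩ := CharP.exists R
  rcases CharP.char_is_prime_or_zero R q with hprime | rfl
  · have hres : ((q : ℕ) : ResidueField R) = 0 := by
      rw [← map_natCast (residue R), CharP.cast_eq_zero, map_zero]
    rw [CharP.cast_eq_zero_iff _ p, Nat.prime_dvd_prime_iff_eq hp hprime] at hres
    exact absurd (hres ▸ CharP.cast_eq_zero R q) h0
  · exact CharP.charP_to_charZero R

/-- For a perfect field `k` of characteristic `p`, the Eisenstein extension of the Witt vectors of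
`k` given by `X ^ e + a p X - p`. -/
theorem exists_dvr_pow_eq {p e : ℕ} (hp : p.Prime) (he : 2 ≤ e) (k : Type u) [Field k] [CharP k p]
    [PerfectField k] (a : ℕ) :
    ∃ (O : Type u) (_ : CommRing O) (_ : IsDomain O) (_ : IsDiscreteValuationRing O) (π : O),
      HenselianLocalRing O ∧ CharZero O ∧ Irreducible π ∧ π ^ e = p * (1 - a * π) ∧
      Associated (p : O) (π ^ e) ∧ Nonempty (k ≃+* ResidueField O) := by
  have : Fact p.Prime := ⟨hp⟩
  have : PerfectRing k p := PerfectField.toPerfectRing p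
  have hirr : Irreducible (p : WittVector p k) := WittVector.irreducible p
  let O := EisensteinExt (p : WittVector p k) a e
  have hdom : IsDomain O := EisensteinExt.isDomain hirr a he
  have hdvr : IsDiscreteValuationRing O := EisensteinExt.isDiscreteValuationRing hirr a he
  have hcomp := EisensteinExt.isAdicComplete hirr (a : WittVector p k) he
  have hmap (n : ℕ) : algebraMap (WittVector p k) O n = n := map_natCast _ n
  let σ : k ≃+* ResidueField O :=
    ((Ideal.quotEquivOfEq hirr.maximalIdeal_eq).trans WittVector.quotientPEquiv).symm.trans
      (EisensteinExt.residueFieldEquiv hirr (a : WittVector p k) he).symm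
  have : CharP (ResidueField O) p :=
    charP_of_injective_ringHom (f := (σ : k →+* ResidueField O)) σ.injective p
  refine ⟨O, inferInstance, hdom, hdvr, EisensteinExt.root _ _ e,
    henselianLocalRing_of_isAdicComplete, ?_, ?_, ?_, ?_, ⟨σ⟩⟩
  · refine charZero_of_charP_residueField hp ?_
    rw [← hmap, Ne, map_eq_zero_iff _ (EisensteinExt.algebraMap_injective _ _ he)]
    exact hirr.ne_zero
  · exact (IsDiscreteValuationRing.irreducible_iff_uniformizer _).2
      (EisensteinExt.maximalIdeal_eq hirr (a : WittVector p k) he)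
  · rw [EisensteinExt.root_pow, hmap, hmap]
  · rw [← hmap]
    exact EisensteinExt.associated_root_pow hirr (a : WittVector p k) he

/-- In the Eisenstein extension by `X ^ e + p X - p`, the prime `p` has no `e`-th root if
`p ∣ e`. -/
theorem pow_ne_of_pow_eq_mul_one_sub {O K : Type*} [CommRing O] [IsDomain O]
    [IsDiscreteValuationRing O] [Field K] [Algebra O K] [IsFractionRing O K] {p e : ℕ}
    (hp : p.Prime) (hpe : p ∣ e) (he : 2 ≤ e) {π : O} (hπ : Irreducible π)
    (h : π ^ e = p * (1 - π)) (ha : Associated (p : O) (π ^ e)) (x : K) : x ^ e ≠ p := by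
  intro hx
  -- A root of `p` in the fraction field is integral over `O`, so it lies in `O`.
  obtain ⟨y, rfl⟩ := IsIntegrallyClosed.exists_algebraMap_eq_of_isIntegral_pow (R := O)
    (show 0 < e by omega) (hx ▸ (map_natCast (algebraMap O K) p ▸ isIntegral_algebraMap))
  refine pow_mul_one_sub_ne_pow hp hpe (by omega) hπ.prime
    ((pow_dvd_pow π he).trans ha.symm.dvd) y ?_
  rw [← map_pow, ← map_natCast (algebraMap O K)] at hx
  rw [IsFractionRing.injective O K hx, h]

section

variable {K : Type u} [Field K] {Γ : Type v} [AddCommGroup Γ] [LinearOrder Γ]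
  [IsOrderedAddMonoid Γ]

theorem not_residueRingDeterminesTheory {p e n : ℕ} (hp : p.Prime) (hpe : p ∣ e) (he : 2 ≤ e)
    (ν : AddValuation K (WithTop Γ)) (hν : IsHenselianMixedChar ν)
    (hchar : CharP (ResField ν) p) (hram : absRamificationIndex ν = e)
    (hperf : PerfectField (ResField ν)) (hΓ : IsOrderedZGroup Γ) (hn : n ≠ 0) (hne : n ≤ e) :
    ¬ ResidueRingDeterminesTheory ν n := by
  intro H
  -- The parameter is chosen so that the comparison field disagrees with `K` on `noRootSentence p
  -- e`.
  obtain ⟨a, ha⟩ : ∃ a : ℕ, (a = 0 ∧ Satisfies ν (noRootSentence p e)) ∨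
      (a = 1 ∧ ¬ Satisfies ν (noRootSentence p e)) := by
    by_cases h : Satisfies ν (noRootSentence p e)
    exacts [⟨0, Or.inl ⟨rfl, h⟩⟩, ⟨1, Or.inr ⟨rfl, h⟩⟩]
  obtain ⟨O, _, _, _, π, _, _, hπ, hroot, hassoc, ⟨σ⟩⟩ := exists_dvr_pow_eq hp he (ResField ν) a
  have : CharP (ResidueField O) p :=
    charP_of_injective_ringHom (f := (σ : ResField ν →+* ResidueField O)) σ.injective p
  -- `ResidueRingDeterminesTheory` ranges over value groups in the universe of `Γ`, hence the lifted
  -- copy of `ℤ`.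
  let ν' : AddValuation (FractionRing O) (WithTop (ULift.{v} ℤ)) := dvrAddVal O (FractionRing O)
  have hν' : IsHenselianMixedChar ν' := isHenselianMixedChar_dvrAddVal O _ hp
  have hram' : absRamificationIndex ν' = e := absRamificationIndex_dvrAddVal O _ hπ hassoc
  let τ : O ≃+* valRing ν' := valRingDVREquiv O (FractionRing O)
  have hres : RingElemEquiv (ResidueRing ν n) (ResidueRing ν' n) := by
    obtain ⟨ϖ, hϖ0, hϖ, hϖe⟩ := exists_uniformizer ν (by omega) hν hchar hram
    -- The bound `n ≤ e` enters here: `p` generates `𝔪 ^ e`, which is contained in `𝔪 ^ n`.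
    have hmem {R : Type u} [CommRing R] [IsLocalRing R] {x : R}
        (hx : maximalIdeal R = Ideal.span {x}) (hp : Associated (p : R) (x ^ e)) :
        (p : R) ∈ maximalIdeal R ^ n := by
      rw [hx, Ideal.span_singleton_pow, Ideal.mem_span_singleton]
      exact (pow_dvd_pow x hne).trans hp.symm.dvd
    have hmaxO := hπ.maximalIdeal_eq
    obtain ⟨f⟩ := nonempty_trunc_equiv_trunc hp hn (hmem hϖ hϖe) (hmem hmaxO hassoc) σ hϖ0 hϖ
      hπ.ne_zero hmaxO
    refine RingElemEquiv.of_ringEquiv (f.trans (Ideal.quotientEquiv _ _ τ ?_))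
    rw [Ideal.map_pow]
    congr 1
    exact (map_ringEquiv_maximalIdeal τ).symm
  have hmod : IsModel ν' (Th ν) := (H (FractionRing O) (ULift.{v} ℤ) ν' hν'
    (hram'.trans hram.symm)).2 ⟨hΓ.ordGroupElemEquiv_uliftInt, hres⟩
  have hiff := hmod.satisfies_iff (noRootSentence p e)
  rw [satisfies_noRootSentence_iff] at hiff
  rcases ha with ⟨rfl, h⟩ | ⟨rfl, h⟩
  -- For `a = 0` the uniformizer is itself an `e`-th root of `p`.
  · refine hiff.2 h (algebraMap O _ π) ?_
    rw [← map_pow, hroot, Nat.cast_zero, zero_mul, sub_zero, mul_one, map_natCast]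
  · rw [Nat.cast_one, one_mul] at hroot
    exact h (hiff.1 (pow_ne_of_pow_eq_mul_one_sub hp hpe he hπ hroot hassoc))

end

end ValuedFieldTheory

theorem proposition4p15 {p e : ℕ} (hp : p.Prime) (hpe : p ∣ e) (he : 2 ≤ e)
    {K : Type u} [Field K] {Γ : Type v} [AddCommGroup Γ] [LinearOrder Γ] [IsOrderedAddMonoid Γ]
    (ν : AddValuation K (WithTop Γ))
    (hν : ValuedFieldTheory.IsHenselianMixedChar ν)
    (hchar : CharP (ValuedFieldTheory.ResField ν) p)
    (hram : ValuedFieldTheory.absRamificationIndex ν = (e : ℕ∞))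
    (hperf : PerfectField (ValuedFieldTheory.ResField ν))
    (hΓ : ValuedFieldTheory.IsOrderedZGroup Γ) :
    (e : ℕ∞) + 1 ≤ ValuedFieldTheory.basarabInvariant ν := by
  refine le_sInf ?_
  rintro _ ⟨n, hn, rfl, H⟩
  by_contra! hlt
  have hne : n ≤ e := Nat.lt_succ_iff.1 (by exact_mod_cast hlt)
  exact ValuedFieldTheory.not_residueRingDeterminesTheory hp hpe he ν hν hchar hram hperf hΓ
    (by omega) hne H
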